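/- Let $p,q\in(0,1)$ and let $R,L\ge 1$ be integers. Let $\Lambda=\{(p,0),\dots,(p,L-1),(q,0),\dots,(q,R-1)\}$ be the set of single-site configurations, where $p$ and $q$ are regarded as distinct labels (modes) even if they are numerically equal; a configuration $(r,i)$ has mode $r$ and $i$ charges. When a walker leaves a site in configuration $\lambda=(r,i)$, it jumps right with probability $r$ and left with probability $1-r$, and the configuration of that site is updated as follows. After a right jump, $(p,i)\mapsto(p,0)$ for all $i$, $(q,i)\mapsto(q,i+1)$ if $i\le R-2$, and $(q,R-1)\mapsto(p,0)$. After a left jump, $(q,i)\mapsto(q,0)$ for all $i$, $(p,i)\mapsto(p,i+1)$ if $i\le L-2$, and $(p,L-1)\mapsto(q,0)$. For an initial environment $\omega\in\Lambda^{\mathbb Z}$ let $\mathbb P_\omega$ be the law of the Markov chain $(X_n,\omega_n)_{n\ge0}$ on $\mathbb Z\times\Lambda^{\mathbb Z}$ with $X_0=0$, $\omega_0=\omega$, in which at each step $X_n$ jumps to $X_n\pm1$ with the probabilities given by the configuration $\omega_n(X_n)$, the configuration at the site $X_n$ is updated by the rule above, and all other sites keep their configurations. The single-site chain is the Markov chain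 on $\Lambda$ of the configurations seen at a site on successive visits to it, with transition matrix $M$; the extended single-site chain, on $\Lambda\times\{1,-1\}$, has as its states the current configuration together with the next jump from the site ($1$ for right, $-1$ for left). Define $$\alpha=\alpha(p,q,R,L)=\frac{p\,(1-q)q^R\bigl(1-(1-p)^L\bigr)+q\,p(1-p)^L(1-q^R)}{(1-q)q^R\bigl(1-(1-p)^L\bigr)+p(1-p)^L(1-q^R)}.$$ Then: 1. $\alpha\in(0,1)$, and $\alpha$ is the stationary fraction of right jumps of the single-site chain: $M$ has a unique stationary probability distribution $\pi$, and $p\sum_{i=0}^{L-1}\pi_{(p,i)}+q\sum_{i=0}^{R-1}\pi_{(q,i)}=\alpha$; likewise the extended chain has a unique stationary probability distribution $\widehat\pi$, and $\sum_{\lambda\in\Lambda}\widehat\pi_{(\lambda,1)}=\alpha$. 2. If $\alpha>1/2$, then for every initial environment $\omega$, $\lim_{n\to\infty}X_n=+\infty$ $\mathbb P_\omega$-almost surely. 3. If $\alpha<1/2$, then for every initial environment $\omega$, $\lim_{n\to\infty}X_n=-\infty$ $\mathbb P_\omega$-almost surely. -/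

import Mathlib

open MeasureTheory ProbabilityTheory Filter

namespace FeedbackWalk

/-- A parameter quadruple `(p, q, R, L)`: `p, q ∈ (0,1)` and `R, L` are positive integers. -/
structure Params where
  p : ℝ
  q : ℝ
  R : ℕ
  L : ℕ
  p_mem : p ∈ Set.Ioo (0 : ℝ) 1
  q_mem : q ∈ Set.Ioo (0 : ℝ) 1
  R_pos : 0 < R
  L_pos : 0 < L

/-- The set `Λ` of single site configurations: `Sum.inl i` is the configuration `(p, i)`,
`0 ≤ i ≤ L - 1`, and `Sum.inr i` is the configuration `(q, i)`, `0 ≤ i ≤ R - 1`. -/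
abbrev Config (θ : Params) : Type := Fin θ.L ⊕ Fin θ.R

/-- Environments: assignments of a configuration to each site of `ℤ`. -/
abbrev Env (θ : Params) : Type := ℤ → Config θ

/-- The states of the walk together with its environment: pairs `(X_n, ω_n)`. -/
abbrev State (θ : Params) : Type := ℤ × Env θ

/-- The probability of a jump to the right from a site in the given configuration. -/
def rightProb (θ : Params) : Config θ → ℝ
  | Sum.inl _ => θ.p
  | Sum.inr _ => θ.q

/-- The probability of the jump `j` (`true` for right, `false` for left) from a site in the
given configuration. -/
def jumpProb (θ : Params) (c : Config θ) (j : Bool) : ℝ :=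
  if j then rightProb θ c else 1 - rightProb θ c

/-- The configuration of a site after a jump from it in direction `j`
(`true` for right, `false` for left). -/
def nextConfig (θ : Params) : Config θ → Bool → Config θ
  | Sum.inl _, true => Sum.inl ⟨0, θ.L_pos⟩
  | Sum.inl i, false =>
      if h : (i : ℕ) + 1 < θ.L then Sum.inl ⟨i + 1, h⟩ else Sum.inr ⟨0, θ.R_pos⟩
  | Sum.inr i, true =>
      if h : (i : ℕ) + 1 < θ.R then Sum.inr ⟨i + 1, h⟩ else Sum.inl ⟨0, θ.L_pos⟩
  | Sum.inr _, false => Sum.inr ⟨0, θ.R_pos⟩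

/-- The displacement of a jump: `1` to the right, `-1` to the left. -/
def displacement (j : Bool) : ℤ := if j then 1 else -1

/-- The new state `(X_{n+1}, ω_{n+1})` after the walk makes the jump `j` from `(X_n, ω_n)`:
only the configuration at the site that the walk leaves is updated. -/
def step (θ : Params) (j : Bool) (s : State θ) : State θ :=
  (s.1 + displacement j, Function.update s.2 s.1 (nextConfig θ (s.2 s.1) j))

theorem rightProb_mem (θ : Params) (c : Config θ) : rightProb θ c ∈ Set.Ioo (0 : ℝ) 1 := by
  cases c
  · exact θ.p_mem
  · exact θ.q_mem

instance (θ : Params) : MeasurableSingletonClass (Config θ) where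
  measurableSet_singleton _ :=
    measurableSet_sum_iff.2 ⟨MeasurableSet.of_discrete, MeasurableSet.of_discrete⟩

theorem measurable_of_config {θ : Params} {β : Type*} [MeasurableSpace β] (f : Config θ → β) :
    Measurable f :=
  measurable_of_finite f

theorem measurable_current (θ : Params) : Measurable (fun s : State θ => s.2 s.1) :=
  measurable_from_prod_countable_right fun x => measurable_pi_apply x

theorem measurable_step (θ : Params) (j : Bool) : Measurable (step θ j) := by
  refine measurable_from_prod_countable_right fun x => ?_
  refine Measurable.prodMk (f := fun _ => x + displacement j) measurable_const ?_
  have h : Measurable fun ω : Env θ => nextConfig θ (ω x) j :=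
    (measurable_of_config fun c => nextConfig θ c j).comp (measurable_pi_apply x)
  exact (measurable_update' (X := fun _ : ℤ => Config θ) (a := x)).comp (measurable_id.prodMk h)

/-- The one-step transition kernel of the Markov chain `(X_n, ω_n)`. -/
noncomputable def stepKernel (θ : Params) : Kernel (State θ) (State θ) where
  toFun s :=
    ENNReal.ofReal (jumpProb θ (s.2 s.1) true) • Measure.dirac (step θ true s) +
      ENNReal.ofReal (jumpProb θ (s.2 s.1) false) • Measure.dirac (step θ false s)
  measurable' := by
    refine Measure.measurable_of_measurable_coe _ fun A hA => ?_
    have h : ∀ j : Bool, Measurable fun s : State θ =>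
        ENNReal.ofReal (jumpProb θ (s.2 s.1) j) * Measure.dirac (step θ j s) A := fun j =>
      ((measurable_of_config fun c => ENNReal.ofReal (jumpProb θ c j)).comp
        (measurable_current θ)).mul
        ((Measure.measurable_coe hA).comp (Measure.measurable_dirac.comp (measurable_step θ j)))
    simpa [Pi.add_def] using (h true).add (h false)

instance (θ : Params) : IsMarkovKernel (stepKernel θ) where
  isProbabilityMeasure s := by
    constructor
    have h := rightProb_mem θ (s.2 s.1)
    simp only [stepKernel, Kernel.coe_mk, Measure.add_apply, Measure.smul_apply, smul_eq_mul,
      measure_univ, mul_one, jumpProb]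
    rw [← ENNReal.ofReal_add (by simpa using h.1.le) (by simpa using h.2.le)]
    simp

/-- The law `ℙ_{ω,k}` of the trajectory `(X_n, ω_n)_{n ≥ 0}` started at `X_0 = k`, `ω_0 = ω`:
the law of the Markov chain with kernel `stepKernel` (Ionescu-Tulcea). -/
noncomputable def walkLaw (θ : Params) (k : ℤ) (ω : Env θ) : Measure (ℕ → State θ) :=
  Kernel.trajMeasure (X := fun _ => State θ) (Measure.dirac (k, ω))
    (fun n => (stepKernel θ).comap (fun h : (Finset.Iic n → State θ) => h ⟨n, by simp⟩)
      (measurable_pi_apply _))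

/-- The path `(X_n)` is right transient. -/
def RightTransient (X : ℕ → ℤ) : Prop := Tendsto X atTop atTop

/-- The path `(X_n)` is left transient. -/
def LeftTransient (X : ℕ → ℤ) : Prop := Tendsto X atTop atBot

/-- The function `α(p, q, R, L)`. -/
noncomputable def alpha (p q : ℝ) (R L : ℕ) : ℝ :=
  (p * ((1 - q) * q ^ R * (1 - (1 - p) ^ L)) + q * (p * (1 - p) ^ L * (1 - q ^ R))) /
    ((1 - q) * q ^ R * (1 - (1 - p) ^ L) + p * (1 - p) ^ L * (1 - q ^ R))

/-- The transition matrix `M` of the single site chain on `Λ`: the configurations seen at a site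
on its successive visits. -/
noncomputable def siteMatrix (θ : Params) : Matrix (Config θ) (Config θ) ℝ :=
  Matrix.of fun c c' => ∑ j : Bool, if nextConfig θ c j = c' then jumpProb θ c j else 0

/-- The transition matrix of the extended single site chain on `Λ × {right, left}`, whose states
are the current configuration of a site together with the next jump from it. -/
noncomputable def extSiteMatrix (θ : Params) :
    Matrix (Config θ × Bool) (Config θ × Bool) ℝ :=
  Matrix.of fun s s' => if nextConfig θ s.1 s.2 = s'.1 then jumpProb θ s'.1 s'.2 else 0

/-- `π` is a stationary probability distribution of the transition matrix `P` on a finite set: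
`π ≥ 0`, `∑ π = 1` and `π = π P`. -/
def IsStationary {S : Type*} [Fintype S] (P : Matrix S S ℝ) (π : S → ℝ) : Prop :=
  π ∈ stdSimplex ℝ S ∧ Matrix.vecMul π P = π

end FeedbackWalk

/-!
The proof is by Lyapunov functions. It does not use the independence of the jumps at different
sites, nor a coupling.

**The site chain.** Within each mode a stationary distribution decays geometrically, and the flows
between the modes must agree; this determines it. The Poisson equation `f - M f = r - α`, where
`r` is the probability of a right jump, has an explicit solution (`sitePotential_poisson`). Paired
with a stationary distribution it shows that the frequency of right jumps is `α`; it is also the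
only fact on the site chain that transience needs.

**The martingale.** Suppose `α > 1 / 2` (for `α < 1 / 2` left and right are exchanged) and put
`ρ = α / (1 - α) > 1`. With a multiple `g` of `f`, a right jump counted as `1 + Δg` and a left jump
counted as `-ρ + Δg` have mean zero. Weigh the jumps from the site `a + y` by `ρ ^ (-y)`: the weight
of a right jump from `y` cancels that of a left jump from `y + 1`, so the weighted numbers of jumps
add up to a function of the position, and
`u (X_n - a) + ∑_{y ≥ 0} ρ ^ (-y) g (ω_n (a + y))`, with `u (y + 1) - u y = ρ ^ (-y)`, is a
martingale while the walk is in `[a, ∞)`. It is bounded there. With `u` continued linearly to the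
left of `a`, the exponential `Φ_a` of a large multiple is a bounded positive submartingale, whose
mean doubles with each step made to the left of `a`
(`LyapunovData.lyap_add_lyapBehind_le`). At and to the right of `a` it is bounded below, uniformly
in `a` and in the environment.

**Transience.** As `Φ_a` is bounded, the sum of its values at the times spent to the left of `a` has
finite mean. So these values tend to `0`, and, `a` being arbitrary, each site is visited finitely
often. Hence, when the walk does not tend to `+∞`, it is infinitely often to the left of `a`, and
the limit of `Φ_a` is `0` (`LyapunovData.ae_tendsto_lyap_of_not_tendsto`). The
submartingale property with `a = X_n` now bounds the conditional probability of `X → +∞`, given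
the first `n` steps, below by a positive constant, and Lévy's zero-one law shows that this event has
probability one (`ae_mem_of_submartingale_family`).
-/

open MeasureTheory ProbabilityTheory Filter

namespace FeedbackWalk

/-! ### The single site chain -/

variable (θ : Params)

theorem one_sub_p_mem : 1 - θ.p ∈ Set.Ioo (0 : ℝ) 1 :=
  ⟨by linarith [θ.p_mem.2], by linarith [θ.p_mem.1]⟩

theorem pow_lt_one_of_mem_Ioo {x : ℝ} (hx : x ∈ Set.Ioo (0 : ℝ) 1) {n : ℕ} (hn : 0 < n) :
    x ^ n < 1 :=
  pow_lt_one₀ hx.1.le hx.2 hn.ne'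

theorem modeWeights_pos : 0 < (1 - θ.q) * θ.q ^ θ.R * (1 - (1 - θ.p) ^ θ.L) ∧
    0 < θ.p * (1 - θ.p) ^ θ.L * (1 - θ.q ^ θ.R) := by
  have h1 := pow_lt_one_of_mem_Ioo (one_sub_p_mem θ) θ.L_pos
  have h2 := pow_lt_one_of_mem_Ioo θ.q_mem θ.R_pos
  have h3 := pow_pos (one_sub_p_mem θ).1 θ.L
  have h4 := pow_pos θ.q_mem.1 θ.R
  have h5 := θ.p_mem.1
  have h6 := θ.q_mem.2
  exact ⟨mul_pos (mul_pos (by linarith) h4) (by linarith),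
    mul_pos (mul_pos h5 h3) (by linarith)⟩

/-- `α` is the average of `p` and `q` with weights proportional to the time that the single site
chain spends in the two modes. -/
theorem alpha_balance :
    (θ.p - alpha θ.p θ.q θ.R θ.L) * ((1 - θ.q) * θ.q ^ θ.R * (1 - (1 - θ.p) ^ θ.L)) +
      (θ.q - alpha θ.p θ.q θ.R θ.L) * (θ.p * (1 - θ.p) ^ θ.L * (1 - θ.q ^ θ.R)) = 0 := by
  obtain ⟨h1, h2⟩ := modeWeights_pos θ
  have h : alpha θ.p θ.q θ.R θ.L * ((1 - θ.q) * θ.q ^ θ.R * (1 - (1 - θ.p) ^ θ.L) +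
      θ.p * (1 - θ.p) ^ θ.L * (1 - θ.q ^ θ.R)) =
      θ.p * ((1 - θ.q) * θ.q ^ θ.R * (1 - (1 - θ.p) ^ θ.L)) +
        θ.q * (θ.p * (1 - θ.p) ^ θ.L * (1 - θ.q ^ θ.R)) :=
    div_mul_cancel₀ _ (add_pos h1 h2).ne'
  linear_combination -h

theorem alpha_mem_Ioo : alpha θ.p θ.q θ.R θ.L ∈ Set.Ioo (0 : ℝ) 1 := by
  obtain ⟨h1, h2⟩ := modeWeights_pos θ
  have hp := θ.p_mem
  have hq := θ.q_mem
  rw [alpha]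
  constructor
  · exact div_pos (add_pos (mul_pos hp.1 h1) (mul_pos hq.1 h2)) (add_pos h1 h2)
  · rw [div_lt_one (add_pos h1 h2)]
    exact add_lt_add (mul_lt_of_lt_one_left h1 hp.2) (mul_lt_of_lt_one_left h2 hq.2)

/-- The difference of the values of `sitePotential` at `(p, 0)` and at `(q, 0)`. -/
noncomputable def modeGap : ℝ :=
  (θ.p - alpha θ.p θ.q θ.R θ.L) * (1 - (1 - θ.p) ^ θ.L) / (θ.p * (1 - θ.p) ^ θ.L)

theorem modeGap_eq : modeGap θ =
    -((θ.q - alpha θ.p θ.q θ.R θ.L) * (1 - θ.q ^ θ.R) / ((1 - θ.q) * θ.q ^ θ.R)) := by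
  have h1 := (pow_pos (one_sub_p_mem θ).1 θ.L).ne'
  have h2 := (pow_pos θ.q_mem.1 θ.R).ne'
  have h3 := θ.p_mem.1.ne'
  have h4 : 1 - θ.q ≠ 0 := by linarith [θ.q_mem.2]
  rw [modeGap, ← neg_div, div_eq_div_iff (mul_ne_zero h3 h1) (mul_ne_zero h4 h2)]
  linear_combination alpha_balance θ

/-- The solution of the Poisson equation of the single site chain, normalized to vanish at
`(q, 0)`. The difference of its values at two configurations is the long-term mean difference in
the number of right jumps from a site which starts in one or in the other. -/
noncomputable def sitePotential : Config θ → ℝ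
  | Sum.inl i => (1 - (1 - θ.p) ^ (θ.L - i)) *
      (modeGap θ + (θ.p - alpha θ.p θ.q θ.R θ.L) / θ.p)
  | Sum.inr i => (1 - θ.q ^ (θ.R - i)) * ((θ.q - alpha θ.p θ.q θ.R θ.L) / (1 - θ.q)) +
      θ.q ^ (θ.R - i) * modeGap θ

theorem sitePotential_p_zero : sitePotential θ (Sum.inl ⟨0, θ.L_pos⟩) = modeGap θ := by
  have h1 := (pow_pos (one_sub_p_mem θ).1 θ.L).ne'
  have h3 := θ.p_mem.1.ne'
  simp only [sitePotential, modeGap, Nat.sub_zero]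
  field_simp
  ring

theorem sitePotential_q_zero : sitePotential θ (Sum.inr ⟨0, θ.R_pos⟩) = 0 := by
  have h2 := (pow_pos θ.q_mem.1 θ.R).ne'
  have h4 : 1 - θ.q ≠ 0 := by linarith [θ.q_mem.2]
  simp only [sitePotential, modeGap_eq, Nat.sub_zero]
  field_simp
  ring

theorem sitePotential_poisson (c : Config θ) :
    rightProb θ c * sitePotential θ (nextConfig θ c true) +
      (1 - rightProb θ c) * sitePotential θ (nextConfig θ c false) =
      sitePotential θ c - (rightProb θ c - alpha θ.p θ.q θ.R θ.L) := by
  have h3 := θ.p_mem.1.ne'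
  have h4 : 1 - θ.q ≠ 0 := by linarith [θ.q_mem.2]
  rcases c with i | i
  · have hnext : sitePotential θ (nextConfig θ (Sum.inl i) false) =
        (1 - (1 - θ.p) ^ (θ.L - (i + 1))) *
          (modeGap θ + (θ.p - alpha θ.p θ.q θ.R θ.L) / θ.p) := by
      by_cases h : (i : ℕ) + 1 < θ.L
      · simp [nextConfig, h, sitePotential]
      · have : θ.L - ((i : ℕ) + 1) = 0 := by omega
        simp only [nextConfig, h, dite_false, sitePotential_q_zero, this]
        simp
    have hpow : (1 - θ.p) ^ (θ.L - i) = (1 - θ.p) * (1 - θ.p) ^ (θ.L - (i + 1)) := by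
      rw [← pow_succ']; congr 1; omega
    rw [hnext]
    simp only [nextConfig, rightProb, sitePotential_p_zero]
    simp only [sitePotential, hpow]
    field_simp
    ring
  · have hnext : sitePotential θ (nextConfig θ (Sum.inr i) true) =
        (1 - θ.q ^ (θ.R - (i + 1))) * ((θ.q - alpha θ.p θ.q θ.R θ.L) / (1 - θ.q)) +
          θ.q ^ (θ.R - (i + 1)) * modeGap θ := by
      by_cases h : (i : ℕ) + 1 < θ.R
      · simp [nextConfig, h, sitePotential]
      · have : θ.R - ((i : ℕ) + 1) = 0 := by omega
        simp only [nextConfig, h, dite_false, sitePotential_p_zero, this]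
        simp
    have hpow : θ.q ^ (θ.R - i) = θ.q * θ.q ^ (θ.R - (i + 1)) := by
      rw [← pow_succ']; congr 1; omega
    rw [hnext]
    simp only [nextConfig, rightProb, sitePotential_q_zero]
    simp only [sitePotential, hpow]
    field_simp
    ring

theorem jumpProb_pos (c : Config θ) (j : Bool) : 0 < jumpProb θ c j := by
  have h := rightProb_mem θ c
  cases j
  · simpa [jumpProb] using h.2
  · simpa [jumpProb] using h.1

theorem sum_jumpProb (c : Config θ) : ∑ j, jumpProb θ c j = 1 := by
  simp [jumpProb]

theorem vecMul_siteMatrix_dotProduct (π h : Config θ → ℝ) :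
    Matrix.vecMul π (siteMatrix θ) ⬝ᵥ h =
      ∑ c, π c * ∑ j, jumpProb θ c j * h (nextConfig θ c j) := by
  rw [← Matrix.dotProduct_mulVec, dotProduct]
  refine Finset.sum_congr rfl fun c _ => ?_
  congr 1
  simp only [Matrix.mulVec, dotProduct, siteMatrix, Matrix.of_apply, Finset.sum_mul]
  rw [Finset.sum_comm]
  refine Finset.sum_congr rfl fun j _ => ?_
  simp

/-- Every stationary distribution of the single site chain makes right jumps with frequency
`α`: pair stationarity with the solution of the Poisson equation. -/
theorem IsStationary.sum_rightProb {π : Config θ → ℝ} (hπ : IsStationary (siteMatrix θ) π) :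
    ∑ c, π c * rightProb θ c = alpha θ.p θ.q θ.R θ.L := by
  have h := vecMul_siteMatrix_dotProduct θ π (sitePotential θ)
  rw [hπ.2, dotProduct] at h
  have h' : ∀ c, π c * ∑ j, jumpProb θ c j * sitePotential θ (nextConfig θ c j) =
      π c * sitePotential θ c - π c * rightProb θ c + π c * alpha θ.p θ.q θ.R θ.L := by
    intro c
    have := sitePotential_poisson θ c
    simp only [Fintype.sum_bool, jumpProb, if_true, Bool.false_eq_true, if_false]
    rw [this]; ring
  simp only [h', Finset.sum_add_distrib, Finset.sum_sub_distrib, ← Finset.sum_mul, hπ.1.2] at h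
  linarith

/-- The geometric profile on `Λ` with mass `a (1 - p) ^ i` at `(p, i)` and `b q ^ i` at
`(q, i)`. -/
def geomProfile (a b : ℝ) : Config θ → ℝ
  | Sum.inl i => a * (1 - θ.p) ^ (i : ℕ)
  | Sum.inr i => b * θ.q ^ (i : ℕ)

/-- Evolution of a geometric profile: only the flow between the two modes,
`a (1 - p) ^ L` from `p` to `q` and `b q ^ R` from `q` to `p`, changes it. -/
theorem geomProfile_evolution (a b : ℝ) (h : Config θ → ℝ) :
    ∑ c, geomProfile θ a b c * ∑ j, jumpProb θ c j * h (nextConfig θ c j) =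
      ∑ c, geomProfile θ a b c * h c + (a * (1 - θ.p) ^ θ.L - b * θ.q ^ θ.R) *
        (h (Sum.inr ⟨0, θ.R_pos⟩) - h (Sum.inl ⟨0, θ.L_pos⟩)) := by
  -- the values along each mode, continued by the configuration entered when the mode changes
  set u : ℕ → ℝ := fun n => if hn : n < θ.L then h (Sum.inl ⟨n, hn⟩)
    else h (Sum.inr ⟨0, θ.R_pos⟩) with hu
  set v : ℕ → ℝ := fun n => if hn : n < θ.R then h (Sum.inr ⟨n, hn⟩)
    else h (Sum.inl ⟨0, θ.L_pos⟩) with hv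
  have hu0 : h (Sum.inl ⟨0, θ.L_pos⟩) = u 0 := by simp [hu, θ.L_pos]
  have hv0 : h (Sum.inr ⟨0, θ.R_pos⟩) = v 0 := by simp [hv, θ.R_pos]
  have huL : u θ.L = v 0 := by simp [hu, hv0]
  have hvR : v θ.R = u 0 := by simp [hv, hu0]
  have hui : ∀ i : Fin θ.L, h (Sum.inl i) = u i := fun i => by simp [hu]
  have hvi : ∀ i : Fin θ.R, h (Sum.inr i) = v i := fun i => by simp [hv]
  have hun : ∀ i : Fin θ.L, h (nextConfig θ (Sum.inl i) false) = u (i + 1) := fun i => by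
    simp only [hu, nextConfig]; split_ifs <;> rfl
  have hvn : ∀ i : Fin θ.R, h (nextConfig θ (Sum.inr i) true) = v (i + 1) := fun i => by
    simp only [hv, nextConfig]; split_ifs <;> rfl
  have htel : ∀ (x y : ℝ) (w : ℕ → ℝ) (n : ℕ),
      ∑ i ∈ Finset.range n, x * y ^ i * ((1 - y) * w 0 + y * w (i + 1)) =
        ∑ i ∈ Finset.range n, x * y ^ i * w i + x * y ^ n * (w n - w 0) := by
    intro x y w n
    induction n with
    | zero => simp
    | succ n ih => rw [Finset.sum_range_succ, Finset.sum_range_succ, ih]; ring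
  have hL : ∑ i : Fin θ.L, geomProfile θ a b (Sum.inl i) *
      ∑ j, jumpProb θ (Sum.inl i) j * h (nextConfig θ (Sum.inl i) j) =
      ∑ i ∈ Finset.range θ.L, a * (1 - θ.p) ^ i *
        ((1 - (1 - θ.p)) * u 0 + (1 - θ.p) * u (i + 1)) := by
    rw [Finset.sum_range]
    refine Finset.sum_congr rfl fun i _ => ?_
    rw [Fintype.sum_bool, hun]
    simp [geomProfile, jumpProb, rightProb, nextConfig, hu0]
  have hR : ∑ i : Fin θ.R, geomProfile θ a b (Sum.inr i) *
      ∑ j, jumpProb θ (Sum.inr i) j * h (nextConfig θ (Sum.inr i) j) =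
      ∑ i ∈ Finset.range θ.R, b * θ.q ^ i * ((1 - θ.q) * v 0 + θ.q * v (i + 1)) := by
    rw [Finset.sum_range]
    refine Finset.sum_congr rfl fun i _ => ?_
    rw [Fintype.sum_bool, hvn]
    simp only [geomProfile, jumpProb, rightProb, nextConfig, hv0, if_true, Bool.false_eq_true,
      if_false]
    ring
  rw [Fintype.sum_sum_type, hL, hR, htel, htel, Fintype.sum_sum_type, hu0, hv0, huL, hvR,
    Finset.sum_range, Finset.sum_range]
  simp only [geomProfile, hui, hvi]
  ring

/-- The stationary distribution of the single site chain. -/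
noncomputable def siteStationary : Config θ → ℝ :=
  fun c => geomProfile θ (θ.q ^ θ.R) ((1 - θ.p) ^ θ.L) c /
    ∑ c', geomProfile θ (θ.q ^ θ.R) ((1 - θ.p) ^ θ.L) c'

theorem geomProfile_pos {a b : ℝ} (ha : 0 < a) (hb : 0 < b) (c : Config θ) :
    0 < geomProfile θ a b c := by
  rcases c with i | i
  · exact mul_pos ha (pow_pos (one_sub_p_mem θ).1 _)
  · exact mul_pos hb (pow_pos θ.q_mem.1 _)

theorem sum_geomProfile_pos :
    0 < ∑ c', geomProfile θ (θ.q ^ θ.R) ((1 - θ.p) ^ θ.L) c' :=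
  Finset.sum_pos (fun c _ => geomProfile_pos θ (pow_pos θ.q_mem.1 _)
    (pow_pos (one_sub_p_mem θ).1 _) c) ⟨Sum.inl ⟨0, θ.L_pos⟩, Finset.mem_univ _⟩

theorem isStationary_siteStationary : IsStationary (siteMatrix θ) (siteStationary θ) := by
  have hpos := sum_geomProfile_pos θ
  refine ⟨⟨fun c => (div_pos (geomProfile_pos θ (pow_pos θ.q_mem.1 _)
    (pow_pos (one_sub_p_mem θ).1 _) c) hpos).le, ?_⟩, ?_⟩
  · simp only [siteStationary]
    rw [← Finset.sum_div, div_self hpos.ne']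
  · refine dotProduct_eq _ _ fun h => ?_
    rw [vecMul_siteMatrix_dotProduct]
    simp only [siteStationary, dotProduct, div_mul_eq_mul_div]
    rw [← Finset.sum_div, ← Finset.sum_div, geomProfile_evolution]
    ring

theorem eq_of_nextConfig_p_succ {n : ℕ} {hn : n + 1 < θ.L} {c : Config θ} {j : Bool}
    (h : nextConfig θ c j = Sum.inl ⟨n + 1, hn⟩) : c = Sum.inl ⟨n, by omega⟩ := by
  rcases c with ⟨i, hi⟩ | ⟨i, hi⟩ <;> cases j <;> simp only [nextConfig] at h <;>
    (try split_ifs at h) <;> simp_all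

theorem eq_of_nextConfig_q_succ {n : ℕ} {hn : n + 1 < θ.R} {c : Config θ} {j : Bool}
    (h : nextConfig θ c j = Sum.inr ⟨n + 1, hn⟩) : c = Sum.inr ⟨n, by omega⟩ := by
  rcases c with ⟨i, hi⟩ | ⟨i, hi⟩ <;> cases j <;> simp only [nextConfig] at h <;>
    (try split_ifs at h) <;> simp_all

/-- A stationary distribution decays geometrically within each mode, because `(p, i + 1)` is
entered only from `(p, i)`, and `(q, i + 1)` only from `(q, i)`. -/
theorem IsStationary.eq_geomProfile {π : Config θ → ℝ} (hπ : IsStationary (siteMatrix θ) π) :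
    π = geomProfile θ (π (Sum.inl ⟨0, θ.L_pos⟩)) (π (Sum.inr ⟨0, θ.R_pos⟩)) := by
  have hcol : ∀ c', π c' = ∑ c, π c * ∑ j, jumpProb θ c j *
      if nextConfig θ c j = c' then 1 else 0 := by
    intro c'
    have h := vecMul_siteMatrix_dotProduct θ π (fun c => if c = c' then 1 else 0)
    rw [hπ.2] at h
    rw [← h]
    simp [dotProduct]
  have hl : ∀ (n : ℕ) (hn : n < θ.L),
      π (Sum.inl ⟨n, hn⟩) = π (Sum.inl ⟨0, θ.L_pos⟩) * (1 - θ.p) ^ n := by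
    intro n
    induction n with
    | zero => intro hn; simp
    | succ n ih =>
      intro hn
      have hn' : n < θ.L := by omega
      rw [hcol, Finset.sum_eq_single (Sum.inl ⟨n, hn'⟩)]
      · rw [ih hn', Fintype.sum_bool]
        simp [nextConfig, jumpProb, rightProb, hn]
        ring
      · intro c _ hc
        have hc' : ∀ j, nextConfig θ c j ≠ Sum.inl ⟨n + 1, hn⟩ := fun j hj =>
          hc (eq_of_nextConfig_p_succ θ hj)
        simp [hc']
      · simp
  have hr : ∀ (n : ℕ) (hn : n < θ.R),
      π (Sum.inr ⟨n, hn⟩) = π (Sum.inr ⟨0, θ.R_pos⟩) * θ.q ^ n := by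
    intro n
    induction n with
    | zero => intro hn; simp
    | succ n ih =>
      intro hn
      have hn' : n < θ.R := by omega
      rw [hcol, Finset.sum_eq_single (Sum.inr ⟨n, hn'⟩)]
      · rw [ih hn', Fintype.sum_bool]
        simp [nextConfig, jumpProb, rightProb, hn]
        ring
      · intro c _ hc
        have hc' : ∀ j, nextConfig θ c j ≠ Sum.inr ⟨n + 1, hn⟩ := fun j hj =>
          hc (eq_of_nextConfig_q_succ θ hj)
        simp [hc']
      · simp
  funext c
  rcases c with ⟨i, hi⟩ | ⟨i, hi⟩
  · exact hl i hi
  · exact hr i hi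

theorem IsStationary.eq_siteStationary {π : Config θ → ℝ}
    (hπ : IsStationary (siteMatrix θ) π) : π = siteStationary θ := by
  set a := π (Sum.inl ⟨0, θ.L_pos⟩)
  set b := π (Sum.inr ⟨0, θ.R_pos⟩)
  have hgeom : π = geomProfile θ a b := hπ.eq_geomProfile
  have hs := pow_pos (one_sub_p_mem θ).1 θ.L
  have hq := pow_pos θ.q_mem.1 θ.R
  have hpos := sum_geomProfile_pos θ
  -- stationarity forces the flows between the two modes to agree
  have hflow : a * (1 - θ.p) ^ θ.L = b * θ.q ^ θ.R := by
    have h := vecMul_siteMatrix_dotProduct θ π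
      (fun c => if c = Sum.inr ⟨0, θ.R_pos⟩ then 1 else 0)
    have h' := geomProfile_evolution θ a b (fun c => if c = Sum.inr ⟨0, θ.R_pos⟩ then 1 else 0)
    rw [hπ.2, dotProduct] at h
    rw [← hgeom, ← h] at h'
    simp at h'
    linarith
  have hscale : ∀ c, geomProfile θ a b c =
      b / (1 - θ.p) ^ θ.L * geomProfile θ (θ.q ^ θ.R) ((1 - θ.p) ^ θ.L) c := by
    intro c
    rcases c with i | i
    · simp only [geomProfile]
      rw [div_mul_eq_mul_div, eq_div_iff hs.ne']
      linear_combination (1 - θ.p) ^ (i : ℕ) * hflow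
    · simp only [geomProfile]
      field_simp
  have hsum : b / (1 - θ.p) ^ θ.L *
      ∑ c, geomProfile θ (θ.q ^ θ.R) ((1 - θ.p) ^ θ.L) c = 1 := by
    rw [Finset.mul_sum]
    refine Eq.trans (Finset.sum_congr rfl fun c _ => ?_) hπ.1.2
    rw [← hscale, ← hgeom]
  funext c
  rw [hgeom, hscale, siteStationary, eq_div_iff hpos.ne']
  linear_combination geomProfile θ (θ.q ^ θ.R) ((1 - θ.p) ^ θ.L) c * hsum

/-! ### The extended single site chain -/

/-- A stationary distribution of the extended chain is the law of a stationary configuration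
together with a jump drawn with the probabilities of that configuration. -/
theorem IsStationary.ext_eq {ν : Config θ × Bool → ℝ} (hν : IsStationary (extSiteMatrix θ) ν) :
    IsStationary (siteMatrix θ) (fun c => ∑ j, ν (c, j)) ∧
      ∀ s, ν s = (∑ j, ν (s.1, j)) * jumpProb θ s.1 s.2 := by
  have hcol : ∀ s', ν s' = (∑ s, if nextConfig θ s.1 s.2 = s'.1 then ν s else 0) *
      jumpProb θ s'.1 s'.2 := by
    intro s'
    conv_lhs => rw [← hν.2]
    simp only [Matrix.vecMul, dotProduct, extSiteMatrix, Matrix.of_apply, Finset.sum_mul]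
    refine Finset.sum_congr rfl fun s _ => ?_
    split_ifs <;> simp
  have hmarg : ∀ c, ∑ j, ν (c, j) = ∑ s, if nextConfig θ s.1 s.2 = c then ν s else 0 := by
    intro c
    rw [Finset.sum_congr rfl fun j _ => hcol (c, j)]
    exact (Finset.mul_sum _ _ _).symm.trans (by rw [sum_jumpProb θ c, mul_one])
  have hprod : ∀ s, ν s = (∑ j, ν (s.1, j)) * jumpProb θ s.1 s.2 := fun s => by
    rw [hmarg]; exact hcol s
  refine ⟨⟨⟨fun c => Finset.sum_nonneg fun j _ => hν.1.1 _, ?_⟩, ?_⟩, hprod⟩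
  · rw [← Fintype.sum_prod_type' (fun c j => ν (c, j))]
    exact hν.1.2
  · funext c'
    rw [hmarg c', Fintype.sum_prod_type]
    simp only [Matrix.vecMul, dotProduct, siteMatrix, Matrix.of_apply, Finset.mul_sum]
    refine Finset.sum_congr rfl fun c _ => Finset.sum_congr rfl fun j _ => ?_
    rw [mul_ite, mul_zero, hprod (c, j)]

/-- The stationary distribution of the extended single site chain. -/
noncomputable def extSiteStationary : Config θ × Bool → ℝ :=
  fun s => siteStationary θ s.1 * jumpProb θ s.1 s.2

theorem sum_extSiteStationary (c : Config θ) :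
    ∑ j, extSiteStationary θ (c, j) = siteStationary θ c := by
  simp only [extSiteStationary, ← Finset.mul_sum, sum_jumpProb, mul_one]

theorem isStationary_extSiteStationary :
    IsStationary (extSiteMatrix θ) (extSiteStationary θ) := by
  have h := isStationary_siteStationary θ
  refine ⟨⟨fun s => mul_nonneg (h.1.1 _) (jumpProb_pos θ _ _).le, ?_⟩, ?_⟩
  · rw [Fintype.sum_prod_type]
    simp only [sum_extSiteStationary, h.1.2]
  · funext s'
    have h' := congrFun h.2 s'.1
    simp only [extSiteStationary]
    rw [← h']
    simp only [Matrix.vecMul, dotProduct, siteMatrix, extSiteMatrix, Matrix.of_apply,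
      Finset.mul_sum, Finset.sum_mul, Fintype.sum_prod_type]
    refine Finset.sum_congr rfl fun c _ => Finset.sum_congr rfl fun j _ => ?_
    split_ifs <;> simp [extSiteStationary]

theorem IsStationary.eq_extSiteStationary {ν : Config θ × Bool → ℝ}
    (hν : IsStationary (extSiteMatrix θ) ν) : ν = extSiteStationary θ := by
  obtain ⟨h1, h2⟩ := hν.ext_eq
  funext s
  rw [h2, extSiteStationary, ← h1.eq_siteStationary]

end FeedbackWalk

/-! ### A zero-one law for submartingales -/

section ZeroOne

variable {Ω : Type*} {m0 : MeasurableSpace Ω} {μ : Measure Ω} [IsProbabilityMeasure μ]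
  {ℱ : Filtration ℕ m0}

/-- A submartingale which is bounded by `B` and tends to `0` off the event `E` is dominated by `B`
times the conditional probabilities of `E`. -/
theorem submartingale_le_condExp_indicator {f : ℕ → Ω → ℝ} (hf : Submartingale f ℱ μ) {B : ℝ}
    (hbdd : ∀ n x, |f n x| ≤ B) {E : Set Ω} (hE : MeasurableSet E)
    (hlim : ∀ᵐ x ∂μ, x ∉ E → Tendsto (fun n => f n x) atTop (nhds 0)) (n : ℕ) :
    f n ≤ᵐ[μ] μ[E.indicator (fun _ => B) | ℱ n] := by
  have hg : Integrable (E.indicator fun _ => B) μ := (integrable_const B).indicator hE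
  suffices f n ≤ᵐ[μ.trim (ℱ.le n)] μ[E.indicator (fun _ => B) | ℱ n] from
    ae_le_of_ae_le_trim this
  refine ae_le_of_forall_setIntegral_le
    ((hf.integrable n).trim (ℱ.le n) (hf.stronglyMeasurable n))
    (integrable_condExp.trim (ℱ.le n) stronglyMeasurable_condExp) fun A hA _ => ?_
  rw [← setIntegral_trim (ℱ.le n) (hf.stronglyMeasurable n) hA,
    ← setIntegral_trim (ℱ.le n) stronglyMeasurable_condExp hA,
    setIntegral_condExp (ℱ.le n) hg hA]
  -- off `E` the part of `f m` that has to be bounded tends to `0`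
  have hlim' : Tendsto (fun m => ∫ x in A, Eᶜ.indicator (f m) x ∂μ) atTop
      (nhds (∫ x in A, (0 : ℝ) ∂μ)) := by
    refine tendsto_integral_of_dominated_convergence (fun _ => B)
      (fun m => ((hf.integrable m).indicator hE.compl).aestronglyMeasurable.restrict)
      (integrable_const B) (fun m => ae_of_all _ fun x => ?_) (ae_restrict_of_ae ?_)
    · exact (norm_indicator_le_norm_self _ _).trans (hbdd m x)
    · filter_upwards [hlim] with x hx
      by_cases hxE : x ∈ E
      · simp [hxE]
      · simpa [hxE] using hx hxE
  rw [integral_zero] at hlim'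
  refine ge_of_tendsto' (x := atTop) (f := fun m =>
    ∫ x in A, Eᶜ.indicator (f (n + m)) x ∂μ + ∫ x in A, E.indicator (fun _ => B) x ∂μ) ?_ fun m => ?_
  · simpa using (hlim'.comp (tendsto_add_atTop_nat n |>.congr fun m => by
      rw [add_comm])).add_const (∫ x in A, E.indicator (fun _ => B) x ∂μ)
  · refine (hf.setIntegral_le (Nat.le_add_right n m) hA).trans ?_
    rw [← integral_add ((hf.integrable _).indicator hE.compl).integrableOn hg.integrableOn]
    refine integral_mono (hf.integrable _).integrableOn
      (((hf.integrable _).indicator hE.compl).add hg).integrableOn fun x => ?_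
    by_cases hxE : x ∈ E
    · simpa [hxE] using (abs_le.1 (hbdd (n + m) x)).2
    · simp [hxE]

/-- If at every time some member of a countable family of bounded submartingales is at least
`δ > 0`, and all of them tend to `0` off the event `E`, then `E` has full measure: by Lévy's
upward theorem the conditional probability of `E` tends to its indicator, but it stays away from
`0`. -/
theorem ae_mem_of_submartingale_family {ι : Type*} [Countable ι] {f : ι → ℕ → Ω → ℝ}
    (hf : ∀ i, Submartingale (f i) ℱ μ) {B δ : ℝ} (hδ : 0 < δ) (hbdd : ∀ i n x, |f i n x| ≤ B)
    {E : Set Ω} (hE : MeasurableSet[⨆ n, ℱ n] E)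
    (hlim : ∀ i, ∀ᵐ x ∂μ, x ∉ E → Tendsto (fun n => f i n x) atTop (nhds 0))
    (hpos : ∀ n x, ∃ i, δ ≤ f i n x) : ∀ᵐ x ∂μ, x ∈ E := by
  have hE0 : MeasurableSet[m0] E := (iSup_le fun n => ℱ.le n : ⨆ n, ℱ n ≤ m0) _ hE
  have hle : ∀ᵐ x ∂μ, ∀ i n, f i n x ≤ (μ[E.indicator (fun _ => B) | ℱ n]) x :=
    ae_all_iff.2 fun i => ae_all_iff.2 fun n =>
      submartingale_le_condExp_indicator (hf i) (hbdd i) hE0 (hlim i) n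
  have hlevy := Integrable.tendsto_ae_condExp (ℱ := ℱ) (μ := μ)
    ((integrable_const B).indicator hE0) (stronglyMeasurable_const.indicator hE)
  filter_upwards [hle, hlevy] with x hx hx'
  by_contra hxE
  have h : δ ≤ E.indicator (fun _ => B) x := ge_of_tendsto' hx' fun n =>
    let ⟨i, hi⟩ := hpos n x
    hi.trans (hx i n)
  rw [Set.indicator_of_notMem hxE] at h
  exact hδ.not_ge h

end ZeroOne

/-! ### The Markov property of the walk -/

namespace FeedbackWalk

variable (θ : Params)

/-- The mean of `f` after one step of the walk from the state `s`. -/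
noncomputable def stepMean (f : State θ → ℝ) (s : State θ) : ℝ :=
  ∑ j, jumpProb θ (s.2 s.1) j * f (step θ j s)

theorem integral_stepKernel {f : State θ → ℝ} (hf : Measurable f) (s : State θ) :
    ∫ t, f t ∂(stepKernel θ s) = stepMean θ f s := by
  have hi : ∀ j, Integrable f
      (ENNReal.ofReal (jumpProb θ (s.2 s.1) j) • Measure.dirac (step θ j s)) := fun j =>
    (integrable_dirac' hf.stronglyMeasurable (by simp)).smul_measure ENNReal.ofReal_ne_top
  simp only [stepKernel, Kernel.coe_mk]
  rw [integral_add_measure (hi true) (hi false), integral_smul_measure, integral_smul_measure,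
    integral_dirac' _ _ hf.stronglyMeasurable, integral_dirac' _ _ hf.stronglyMeasurable,
    ENNReal.toReal_ofReal (jumpProb_pos θ _ _).le, ENNReal.toReal_ofReal (jumpProb_pos θ _ _).le]
  simp [stepMean]

theorem measurable_stepMean {f : State θ → ℝ} (hf : Measurable f) :
    Measurable (stepMean θ f) :=
  Finset.measurable_sum _ fun j _ =>
    ((measurable_of_config fun c => jumpProb θ c j).comp (measurable_current θ)).mul
      (hf.comp (measurable_step θ j))

instance (k : ℤ) (ω : Env θ) : IsProbabilityMeasure (walkLaw θ k ω) := by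
  unfold walkLaw; infer_instance

/-- The natural filtration of the trajectories. -/
abbrev pathFiltration : Filtration ℕ (MeasurableSpace.pi : MeasurableSpace (ℕ → State θ)) :=
  Filtration.piLE (X := fun _ => State θ)

theorem measurable_eval_pathFiltration (n : ℕ) :
    Measurable[pathFiltration θ n] fun s : ℕ → State θ => s n := by
  rw [pathFiltration, Filtration.piLE_eq_comap_frestrictLe]
  exact (measurable_pi_apply (X := fun _ : Finset.Iic n => State θ) ⟨n, by simp⟩).comp
    (comap_measurable (Preorder.frestrictLe (π := fun _ => State θ) n))

/-- The Markov property, tested on bounded functions. -/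
theorem setIntegral_walkLaw_succ (k : ℤ) (ω : Env θ) {f : State θ → ℝ} (hf : Measurable f)
    {B : ℝ} (hB : ∀ s, |f s| ≤ B) (n : ℕ) {A : Set (ℕ → State θ)}
    (hA : MeasurableSet[pathFiltration θ n] A) :
    ∫ s in A, f (s (n + 1)) ∂(walkLaw θ k ω) = ∫ s in A, stepMean θ f (s n) ∂(walkLaw θ k ω) := by
  rw [pathFiltration, Filtration.piLE_eq_comap_frestrictLe] at hA
  obtain ⟨T, hT, rfl⟩ := hA
  have hkey := Kernel.map_frestrictLe_trajMeasure_compProd_eq_map_trajMeasure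
    (X := fun _ => State θ) (μ₀ := Measure.dirac (k, ω))
    (κ := fun n => (stepKernel θ).comap (fun h : (Finset.Iic n → State θ) => h ⟨n, by simp⟩)
      (measurable_pi_apply _)) (a := n)
  change (walkLaw θ k ω).map _ ⊗ₘ _ = (walkLaw θ k ω).map _ at hkey
  have hm : Measurable fun s : ℕ → State θ =>
      (Preorder.frestrictLe (π := fun _ => State θ) n s, s (n + 1)) := by fun_prop
  have hm' : Measurable (Preorder.frestrictLe (π := fun _ => State θ) n) := by fun_prop
  calc ∫ s in Preorder.frestrictLe n ⁻¹' T, f (s (n + 1)) ∂(walkLaw θ k ω)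
      = ∫ z in T ×ˢ Set.univ, f z.2 ∂((walkLaw θ k ω).map fun s =>
          (Preorder.frestrictLe (π := fun _ => State θ) n s, s (n + 1))) := by
        rw [setIntegral_map (f := fun z : (Finset.Iic n → State θ) × State θ => f z.2)
          (hT.prod MeasurableSet.univ) (hf.comp measurable_snd).aestronglyMeasurable
          hm.aemeasurable]
        congr 2
        ext s
        simp
    _ = ∫ h in T, stepMean θ f (h ⟨n, by simp⟩)
          ∂((walkLaw θ k ω).map (Preorder.frestrictLe (π := fun _ => State θ) n)) := by
        rw [← hkey, Measure.setIntegral_compProd hT MeasurableSet.univ]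
        · simp only [Measure.restrict_univ, Kernel.comap_apply, integral_stepKernel θ hf]
        · have : IsProbabilityMeasure
              ((walkLaw θ k ω).map (Preorder.frestrictLe (π := fun _ => State θ) n)) :=
            Measure.isProbabilityMeasure_map hm'.aemeasurable
          exact (Integrable.of_bound (hf.comp measurable_snd).aestronglyMeasurable B
            (ae_of_all _ fun z => hB z.2)).integrableOn
    _ = _ := by
        rw [setIntegral_map hT _ hm'.aemeasurable]
        · rfl
        · exact ((measurable_stepMean θ hf).comp
            (measurable_pi_apply (X := fun _ : Finset.Iic n => State θ)
              ⟨n, by simp⟩)).aestronglyMeasurable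

/-! ### The Lyapunov function -/

/-- The scale function of a walk whose jumps balance when a step backwards weighs `ρ` times a step
forwards: its increment over `[y, y + 1]` is `ρ⁻¹ ^ y` for `y ≥ 0`, so that it is bounded above,
and it is continued to the negative integers with the slope `ρ`. -/
noncomputable def scale (ρ : ℝ) (y : ℤ) : ℝ :=
  if 0 ≤ y then (1 - ρ⁻¹ ^ y.toNat) / (1 - ρ⁻¹) else ρ * y

section Scale

variable {ρ : ℝ}

theorem inv_mem_Ioo (hρ : 1 < ρ) : ρ⁻¹ ∈ Set.Ioo (0 : ℝ) 1 :=
  ⟨by positivity, inv_lt_one_of_one_lt₀ hρ⟩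

theorem scale_add_one (hρ : 1 < ρ) {y : ℤ} (hy : 0 ≤ y) :
    scale ρ (y + 1) = scale ρ y + ρ⁻¹ ^ y.toNat := by
  lift y to ℕ using hy
  have h := (inv_mem_Ioo hρ).2
  have h' : 1 - ρ⁻¹ ≠ 0 := by linarith
  have e : ((y : ℤ) + 1).toNat = y + 1 := by omega
  rw [scale, scale, if_pos (by positivity), if_pos (by positivity), e, Int.toNat_natCast, pow_succ]
  generalize ρ⁻¹ = r at *
  field_simp
  ring

theorem scale_add_one_of_neg {y : ℤ} (hy : y < 0) :
    scale ρ (y + 1) = scale ρ y + ρ := by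
  rcases eq_or_lt_of_le (Int.add_one_le_of_lt hy) with h | h
  · have : y = -1 := by omega
    subst this
    simp [scale]
  · rw [scale, scale, if_neg (by omega), if_neg (by omega)]
    push_cast
    ring

theorem scale_sub_one (hρ : 1 < ρ) {y : ℤ} (hy : 0 ≤ y) :
    scale ρ (y - 1) = scale ρ y - ρ * ρ⁻¹ ^ y.toNat := by
  rcases eq_or_lt_of_le hy with h | h
  · have := scale_add_one_of_neg (ρ := ρ) (y := y - 1) (by omega)
    rw [sub_add_cancel] at this
    rw [this, ← h]
    simp
  · have := scale_add_one hρ (y := y - 1) (by omega)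
    have e : y.toNat = (y - 1).toNat + 1 := by omega
    rw [sub_add_cancel] at this
    rw [this, e, pow_succ]
    field_simp
    ring

theorem scale_nonneg (hρ : 1 < ρ) {y : ℤ} (hy : 0 ≤ y) : 0 ≤ scale ρ y := by
  have h := inv_mem_Ioo hρ
  rw [scale, if_pos hy]
  exact div_nonneg (sub_nonneg.2 (pow_le_one₀ h.1.le h.2.le)) (by linarith [h.2])

theorem scale_le (hρ : 1 < ρ) (y : ℤ) : scale ρ y ≤ (1 - ρ⁻¹)⁻¹ := by
  have h := inv_mem_Ioo hρ
  have h1 : 0 < 1 - ρ⁻¹ := by linarith [h.2]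
  rw [scale]
  split_ifs with hy
  · rw [← one_div (1 - ρ⁻¹)]
    exact div_le_div_of_nonneg_right (by linarith [pow_pos h.1 y.toNat]) h1.le
  · have : (y : ℝ) < 0 := by exact_mod_cast not_le.1 hy
    have : ρ * y < 0 := mul_neg_of_pos_of_neg (by linarith) this
    linarith [inv_pos.2 h1]

end Scale

/-- The data of a Lyapunov function for the walk in the direction `fwd` (`true` for right). Forward
jumps of weight `1` and backward jumps of weight `-ρ`, with `ρ > 1`, balance on average, up to the
increments of a bounded function `g` of the configuration of the site that the walk leaves. The
rate `b` is so large that multiplication by `exp (b ρ)` makes up, twice over, for the least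
probability of a forward jump. -/
structure LyapunovData (θ : Params) where
  fwd : Bool
  ρ : ℝ
  g : Config θ → ℝ
  K : ℝ
  b : ℝ
  one_lt : 1 < ρ
  abs_g_le : ∀ c, |g c| ≤ K
  balance : ∀ c, jumpProb θ c fwd * (1 + g (nextConfig θ c fwd)) +
    jumpProb θ c (!fwd) * (-ρ + g (nextConfig θ c (!fwd))) = g c
  b_pos : 0 < b
  two_le : ∀ c, 2 ≤ jumpProb θ c fwd * Real.exp (b * ρ)

theorem displacement_not (j : Bool) : displacement (!j) = -displacement j := by
  cases j <;> simp [displacement]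

theorem displacement_mul_self (j : Bool) : displacement j * displacement j = 1 := by
  cases j <;> simp [displacement]

namespace LyapunovData

variable {θ : Params} (D : LyapunovData θ)

/-- The signed distance from the site `a` to the site `x` in the forward direction. -/
def dist (a x : ℤ) : ℤ := displacement D.fwd * (x - a)

/-- The site at signed distance `y` from `a` in the forward direction. -/
def site (a y : ℤ) : ℤ := a + displacement D.fwd * y

theorem dist_site (a y : ℤ) : D.dist a (D.site a y) = y := by
  rw [dist, site, add_sub_cancel_left, ← mul_assoc, displacement_mul_self, one_mul]

theorem site_dist (a x : ℤ) : D.site a (D.dist a x) = x := by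
  rw [dist, site, ← mul_assoc, displacement_mul_self]
  ring

theorem dist_add_displacement (a x : ℤ) : D.dist a (x + displacement D.fwd) = D.dist a x + 1 := by
  rw [dist, dist, ← displacement_mul_self D.fwd]
  ring

theorem dist_add_displacement_not (a x : ℤ) :
    D.dist a (x + displacement (!D.fwd)) = D.dist a x - 1 := by
  rw [dist, dist, displacement_not, ← displacement_mul_self D.fwd]
  ring

/-- The correction that the environment ahead of the site `a` makes to the scale function. -/
noncomputable def correction (a : ℤ) (ω : Env θ) : ℝ :=
  ∑' i : ℕ, D.ρ⁻¹ ^ i * D.g (ω (D.site a i))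

/-- The sum of the weights `ρ⁻¹ ^ i`: it bounds the scale function from above and, multiplied by
`K`, the correction. -/
noncomputable def scaleBound : ℝ := (1 - D.ρ⁻¹)⁻¹

theorem hasSum_pow : HasSum (fun i : ℕ => D.ρ⁻¹ ^ i) D.scaleBound :=
  hasSum_geometric_of_lt_one (inv_mem_Ioo D.one_lt).1.le (inv_mem_Ioo D.one_lt).2

theorem norm_term_le (a : ℤ) (ω : Env θ) (i : ℕ) :
    ‖D.ρ⁻¹ ^ i * D.g (ω (D.site a i))‖ ≤ D.ρ⁻¹ ^ i * D.K := by
  have h : 0 ≤ D.ρ⁻¹ ^ i := pow_nonneg (inv_mem_Ioo D.one_lt).1.le i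
  rw [norm_mul, Real.norm_of_nonneg h]
  exact mul_le_mul_of_nonneg_left (D.abs_g_le _) h

theorem summable_correction (a : ℤ) (ω : Env θ) :
    Summable fun i : ℕ => D.ρ⁻¹ ^ i * D.g (ω (D.site a i)) :=
  .of_norm_bounded (D.hasSum_pow.mul_right D.K).summable (D.norm_term_le a ω)

theorem abs_correction_le (a : ℤ) (ω : Env θ) : |D.correction a ω| ≤ D.scaleBound * D.K :=
  tsum_of_norm_bounded (D.hasSum_pow.mul_right D.K) (D.norm_term_le a ω)

theorem measurable_correction (a : ℤ) : Measurable (D.correction a) := by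
  refine measurable_of_tendsto_metrizable (f := fun (n : ℕ) (ω : Env θ) =>
    ∑ i ∈ Finset.range n, D.ρ⁻¹ ^ i * D.g (ω (D.site a i))) (fun n => ?_)
    (tendsto_pi_nhds.2 fun ω => (D.summable_correction a ω).hasSum.tendsto_sum_nat)
  exact Finset.measurable_sum _ fun i _ =>
    measurable_const.mul ((measurable_of_config D.g).comp (measurable_pi_apply _))

theorem correction_update_of_neg {a x : ℤ} (hx : D.dist a x < 0) (ω : Env θ) (c : Config θ) :
    D.correction a (Function.update ω x c) = D.correction a ω := by
  refine tsum_congr fun i => ?_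
  rw [Function.update_of_ne]
  rintro rfl
  rw [dist_site] at hx
  omega

theorem correction_update {a x : ℤ} (hx : 0 ≤ D.dist a x) (ω : Env θ) (c : Config θ) :
    D.correction a (Function.update ω x c) =
      D.correction a ω + D.ρ⁻¹ ^ (D.dist a x).toNat * (D.g c - D.g (ω x)) := by
  have hn : D.site a ((D.dist a x).toNat : ℤ) = x := by
    rw [Int.toNat_of_nonneg hx, site_dist]
  have h : (fun i : ℕ => D.ρ⁻¹ ^ i * D.g (Function.update ω x c (D.site a i))) =
      Function.update (fun i : ℕ => D.ρ⁻¹ ^ i * D.g (ω (D.site a i))) (D.dist a x).toNat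
        (D.ρ⁻¹ ^ (D.dist a x).toNat * D.g c) := by
    funext i
    rcases eq_or_ne i (D.dist a x).toNat with rfl | hi
    · rw [Function.update_self, hn, Function.update_self]
    · rw [Function.update_of_ne hi, Function.update_of_ne]
      rintro rfl
      rw [dist_site] at hi
      omega
  have hsum := (D.summable_correction a ω).hasSum.update (D.dist a x).toNat
    (D.ρ⁻¹ ^ (D.dist a x).toNat * D.g c)
  rw [← h] at hsum
  rw [correction, hsum.tsum_eq, hn, correction]
  ring

/-- The potential of a state: the scale function of the position, seen from the site `a`, plus the
correction by the environment. It is a martingale while the walk is ahead of `a`. -/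
noncomputable def potential (a : ℤ) (s : State θ) : ℝ :=
  scale D.ρ (D.dist a s.1) + D.correction a s.2

/-- The Lyapunov function centred at the site `a`. -/
noncomputable def lyap (a : ℤ) (s : State θ) : ℝ := Real.exp (D.b * D.potential a s)

theorem measurable_lyap (a : ℤ) : Measurable (D.lyap a) := by
  refine Real.measurable_exp.comp (measurable_const.mul (Measurable.add ?_ ?_))
  · exact (measurable_of_countable fun x : ℤ => scale D.ρ (D.dist a x)).comp measurable_fst
  · exact (D.measurable_correction a).comp measurable_snd

theorem lyap_pos (a : ℤ) (s : State θ) : 0 < D.lyap a s := Real.exp_pos _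

/-- An upper bound of the Lyapunov functions. -/
noncomputable def lyapBound : ℝ := Real.exp (D.b * (D.scaleBound + D.scaleBound * D.K))

theorem lyap_le (a : ℤ) (s : State θ) : D.lyap a s ≤ D.lyapBound :=
  Real.exp_le_exp.2 <| mul_le_mul_of_nonneg_left
    (add_le_add (scale_le D.one_lt _) (abs_le.1 (D.abs_correction_le a s.2)).2) D.b_pos.le

theorem abs_lyap_le (a : ℤ) (s : State θ) : |D.lyap a s| ≤ D.lyapBound := by
  rw [abs_of_pos (D.lyap_pos a s)]
  exact D.lyap_le a s

/-- A lower bound of the Lyapunov functions at and ahead of their centre. -/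
noncomputable def lyapFloor : ℝ := Real.exp (D.b * -(D.scaleBound * D.K))

theorem lyapFloor_le {a : ℤ} {s : State θ} (h : 0 ≤ D.dist a s.1) : D.lyapFloor ≤ D.lyap a s := by
  refine Real.exp_le_exp.2 <| mul_le_mul_of_nonneg_left ?_ D.b_pos.le
  have h1 := (abs_le.1 (D.abs_correction_le a s.2)).1
  have h2 := scale_nonneg D.one_lt h
  rw [potential]
  linarith

theorem lyap_ge_of_dist_eq_neg_one {a : ℤ} {s : State θ} (h : D.dist a s.1 = -1) :
    D.lyapFloor * Real.exp (-(D.b * D.ρ)) ≤ D.lyap a s := by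
  rw [lyapFloor, ← Real.exp_add, lyap, potential, h]
  refine Real.exp_le_exp.2 ?_
  have h1 := (abs_le.1 (D.abs_correction_le a s.2)).1
  have h2 := mul_le_mul_of_nonneg_left h1 D.b_pos.le
  have h3 : scale D.ρ (-1) = -D.ρ := by simp [scale]
  rw [h3]
  linarith

theorem stepMean_eq (f : State θ → ℝ) (s : State θ) :
    stepMean θ f s = jumpProb θ (s.2 s.1) D.fwd * f (step θ D.fwd s) +
      jumpProb θ (s.2 s.1) (!D.fwd) * f (step θ (!D.fwd) s) := by
  rw [stepMean, Fintype.sum_bool]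
  cases D.fwd
  · exact add_comm _ _
  · rfl

theorem jumpProb_add (c : Config θ) : jumpProb θ c D.fwd + jumpProb θ c (!D.fwd) = 1 := by
  cases D.fwd <;> simp [jumpProb]

/-- Ahead of the centre the potential is a martingale, and its exponential is a submartingale. -/
theorem lyap_le_stepMean {a : ℤ} {s : State θ} (h : 0 ≤ D.dist a s.1) :
    D.lyap a s ≤ stepMean θ (D.lyap a) s := by
  set c := s.2 s.1
  set w := D.ρ⁻¹ ^ (D.dist a s.1).toNat
  have hf : D.potential a (step θ D.fwd s) = D.potential a s +
      w * (1 + D.g (nextConfig θ c D.fwd) - D.g c) := by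
    rw [potential, step, D.dist_add_displacement, scale_add_one D.one_lt h,
      D.correction_update h, potential]
    ring
  have hb : D.potential a (step θ (!D.fwd) s) = D.potential a s +
      w * (-D.ρ + D.g (nextConfig θ c (!D.fwd)) - D.g c) := by
    rw [potential, step, D.dist_add_displacement_not, scale_sub_one D.one_lt h,
      D.correction_update h, potential]
    ring
  have hexp : ∀ x, D.lyap a s * (1 + D.b * x) ≤ Real.exp (D.b * (D.potential a s + x)) := by
    intro x
    rw [mul_add D.b, Real.exp_add, lyap]
    exact mul_le_mul_of_nonneg_left (by linarith [Real.add_one_le_exp (D.b * x)])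
      (Real.exp_pos _).le
  rw [D.stepMean_eq]
  have h1 := mul_le_mul_of_nonneg_left (hexp (w * (1 + D.g (nextConfig θ c D.fwd) - D.g c)))
    (jumpProb_pos θ c D.fwd).le
  have h2 := mul_le_mul_of_nonneg_left
    (hexp (w * (-D.ρ + D.g (nextConfig θ c (!D.fwd)) - D.g c))) (jumpProb_pos θ c (!D.fwd)).le
  rw [← hf] at h1
  rw [← hb] at h2
  refine le_trans (le_of_eq ?_) (add_le_add h1 h2)
  linear_combination (-D.lyap a s * D.b * w) * D.balance c +
    (D.lyap a s * D.b * w * D.g c - D.lyap a s) * D.jumpProb_add c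

/-- Behind the centre the mean of the Lyapunov function doubles with each step. -/
theorem two_mul_lyap_le_stepMean {a : ℤ} {s : State θ} (h : D.dist a s.1 < 0) :
    2 * D.lyap a s ≤ stepMean θ (D.lyap a) s := by
  have hf : D.potential a (step θ D.fwd s) = D.potential a s + D.ρ := by
    rw [potential, step, D.dist_add_displacement, scale_add_one_of_neg h,
      D.correction_update_of_neg h, potential]
    ring
  rw [D.stepMean_eq]
  refine le_trans ?_ (le_add_of_nonneg_right
    (mul_nonneg (jumpProb_pos θ _ _).le (D.lyap_pos a _).le))
  rw [lyap, lyap, hf, mul_add, Real.exp_add]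
  have := mul_le_mul_of_nonneg_left (D.two_le (s.2 s.1)) (Real.exp_pos (D.b * D.potential a s)).le
  linarith

/-- The Lyapunov function restricted to the states behind the centre. -/
noncomputable def lyapBehind (a : ℤ) : State θ → ℝ :=
  {s : State θ | D.dist a s.1 < 0}.indicator (D.lyap a)

theorem measurable_lyapBehind (a : ℤ) : Measurable (D.lyapBehind a) :=
  (D.measurable_lyap a).indicator
    (measurable_fst (MeasurableSet.of_discrete (s := {x : ℤ | D.dist a x < 0})))

theorem lyapBehind_nonneg (a : ℤ) (s : State θ) : 0 ≤ D.lyapBehind a s :=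
  Set.indicator_nonneg (fun s _ => (D.lyap_pos a s).le) s

theorem abs_lyapBehind_le (a : ℤ) (s : State θ) : |D.lyapBehind a s| ≤ D.lyapBound :=
  (norm_indicator_le_norm_self (D.lyap a) s).trans (D.abs_lyap_le a s)

theorem lyap_add_lyapBehind_le (a : ℤ) (s : State θ) :
    D.lyap a s + D.lyapBehind a s ≤ stepMean θ (D.lyap a) s := by
  by_cases h : D.dist a s.1 < 0
  · have := D.two_mul_lyap_le_stepMean h
    simp only [lyapBehind, Set.indicator, Set.mem_ofPred_eq, h, if_true]
    linarith
  · have := D.lyap_le_stepMean (not_lt.1 h)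
    simpa [lyapBehind, Set.indicator, h] using this

end LyapunovData

/-! ### Transience -/

namespace LyapunovData

variable {θ : Params} (D : LyapunovData θ) (k : ℤ) (ω : Env θ)

theorem integrable_eval {f : State θ → ℝ} (hf : Measurable f) {B : ℝ} (hB : ∀ s, |f s| ≤ B)
    (n : ℕ) : Integrable (fun s : ℕ → State θ => f (s n)) (walkLaw θ k ω) :=
  .of_bound (hf.comp (measurable_pi_apply n)).aestronglyMeasurable B (ae_of_all _ fun s => hB (s n))

theorem setIntegral_lyap_add_le (a : ℤ) (n : ℕ) {A : Set (ℕ → State θ)}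
    (hA : MeasurableSet[pathFiltration θ n] A) :
    ∫ s in A, D.lyap a (s n) ∂(walkLaw θ k ω) + ∫ s in A, D.lyapBehind a (s n) ∂(walkLaw θ k ω) ≤
      ∫ s in A, D.lyap a (s (n + 1)) ∂(walkLaw θ k ω) := by
  have h1 := integrable_eval k ω (D.measurable_lyap a) (D.abs_lyap_le a) n
  have h2 := integrable_eval k ω (D.measurable_lyapBehind a) (D.abs_lyapBehind_le a) n
  have h3 : Integrable (fun s : ℕ → State θ => stepMean θ (D.lyap a) (s n)) (walkLaw θ k ω) := by
    refine integrable_eval k ω (measurable_stepMean θ (D.measurable_lyap a))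
      (B := D.lyapBound) (fun s => abs_le.2 ⟨?_, ?_⟩) n
    · have := D.lyap_add_lyapBehind_le a s
      linarith [D.lyap_pos a s, D.lyapBehind_nonneg a s, (D.lyap_pos a s).trans_le (D.lyap_le a s)]
    · rw [stepMean, ← one_mul D.lyapBound, ← sum_jumpProb θ (s.2 s.1), Finset.sum_mul]
      exact Finset.sum_le_sum fun j _ =>
        mul_le_mul_of_nonneg_left (D.lyap_le a _) (jumpProb_pos θ _ _).le
  rw [setIntegral_walkLaw_succ θ k ω (D.measurable_lyap a) (D.abs_lyap_le a) n hA,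
    ← integral_add h1.integrableOn h2.integrableOn]
  exact integral_mono (h1.add h2).integrableOn h3.integrableOn
    fun s => D.lyap_add_lyapBehind_le a (s n)

theorem submartingale_lyap (a : ℤ) :
    Submartingale (fun n (s : ℕ → State θ) => D.lyap a (s n)) (pathFiltration θ)
      (walkLaw θ k ω) := by
  refine submartingale_of_setIntegral_le_succ (fun n => ?_)
    (fun n => integrable_eval k ω (D.measurable_lyap a) (D.abs_lyap_le a) n) fun n A hA => ?_
  · exact ((D.measurable_lyap a).comp (measurable_eval_pathFiltration θ n)).stronglyMeasurable
  · exact (le_add_of_nonneg_right (integral_nonneg fun s => D.lyapBehind_nonneg a (s n))).trans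
      (D.setIntegral_lyap_add_le k ω a n hA)

/-- The time spent behind `a`, weighted by the Lyapunov function, has finite mean. -/
theorem sum_integral_lyapBehind_le (a : ℤ) (n : ℕ) :
    ∑ i ∈ Finset.range n, ∫ s, D.lyapBehind a (s i) ∂(walkLaw θ k ω) ≤ D.lyapBound := by
  have h : ∀ n : ℕ, ∑ i ∈ Finset.range n, ∫ s, D.lyapBehind a (s i) ∂(walkLaw θ k ω) ≤
      ∫ s, D.lyap a (s n) ∂(walkLaw θ k ω) := by
    intro n
    induction n with
    | zero => simpa using integral_nonneg fun s : ℕ → State θ => (D.lyap_pos a (s 0)).le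
    | succ n ih =>
      have := D.setIntegral_lyap_add_le k ω a n MeasurableSet.univ
      simp only [Measure.restrict_univ] at this
      rw [Finset.sum_range_succ]
      linarith
  refine (h n).trans ((integral_mono (integrable_eval k ω (D.measurable_lyap a)
    (D.abs_lyap_le a) n) (integrable_const D.lyapBound) fun s => D.lyap_le a (s n)).trans ?_)
  simp

theorem ae_tendsto_lyapBehind (a : ℤ) : ∀ᵐ s ∂(walkLaw θ k ω),
    Tendsto (fun n => D.lyapBehind a (s n)) atTop (nhds 0) := by
  have hm : ∀ n, Measurable fun s : ℕ → State θ => ENNReal.ofReal (D.lyapBehind a (s n)) :=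
    fun n => ((D.measurable_lyapBehind a).comp (measurable_pi_apply n)).ennreal_ofReal
  have hfin : ∫⁻ s, ∑' n, ENNReal.ofReal (D.lyapBehind a (s n)) ∂(walkLaw θ k ω) ≠ ⊤ := by
    rw [lintegral_tsum fun n => (hm n).aemeasurable]
    refine ne_top_of_le_ne_top (ENNReal.ofReal_ne_top (r := D.lyapBound)) ?_
    refine ENNReal.tsum_le_of_sum_range_le fun n => ?_
    have hi : ∀ i, ∫⁻ s, ENNReal.ofReal (D.lyapBehind a (s i)) ∂(walkLaw θ k ω) =
        ENNReal.ofReal (∫ s, D.lyapBehind a (s i) ∂(walkLaw θ k ω)) := fun i =>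
      (ofReal_integral_eq_lintegral_ofReal
        (integrable_eval k ω (D.measurable_lyapBehind a) (D.abs_lyapBehind_le a) i)
        (ae_of_all _ fun s => D.lyapBehind_nonneg a (s i))).symm
    simp only [hi]
    rw [← ENNReal.ofReal_sum_of_nonneg fun i _ =>
      integral_nonneg fun s => D.lyapBehind_nonneg a (s i)]
    exact ENNReal.ofReal_le_ofReal (D.sum_integral_lyapBehind_le k ω a n)
  filter_upwards [ae_lt_top (Measurable.tsum hm) hfin] with s hs
  have h := ENNReal.tendsto_atTop_zero_of_tsum_ne_top hs.ne
  have h' := (ENNReal.tendsto_toReal ENNReal.zero_ne_top).comp h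
  simpa [Function.comp_def, ENNReal.toReal_ofReal (D.lyapBehind_nonneg a _)] using h'

/-- A path along which the Lyapunov functions behind their centres tend to `0` visits every site
only finitely often. -/
theorem eventually_ne_site {s : ℕ → State θ}
    (h : ∀ a, Tendsto (fun n => D.lyapBehind a (s n)) atTop (nhds 0)) (z : ℤ) :
    ∀ᶠ n in atTop, (s n).1 ≠ z := by
  have hz : D.dist (z + displacement D.fwd) z = -1 := by
    rw [dist, ← displacement_mul_self D.fwd]
    ring
  have hpos : 0 < D.lyapFloor * Real.exp (-(D.b * D.ρ)) :=
    mul_pos (Real.exp_pos _) (Real.exp_pos _)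
  filter_upwards [(h (z + displacement D.fwd)).eventually_lt_const hpos] with n hn hzn
  rw [← hzn] at hz
  have h1 := D.lyap_ge_of_dist_eq_neg_one hz
  have h2 : D.dist ((s n).1 + displacement D.fwd) (s n).1 < 0 := by rw [hz]; norm_num
  rw [← hzn, lyapBehind, Set.indicator_of_mem (by exact h2)] at hn
  exact hn.not_ge h1

theorem tendsto_dist_of_eventually_nonneg {x : ℕ → ℤ} {a : ℤ}
    (hx : ∀ᶠ n in atTop, 0 ≤ D.dist a (x n)) (hz : ∀ z, ∀ᶠ n in atTop, x n ≠ z) :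
    Tendsto (fun n => D.dist 0 (x n)) atTop atTop := by
  have h : Tendsto (fun n => D.dist a (x n)) atTop atTop := by
    refine tendsto_atTop.2 fun m => ?_
    have hall : ∀ᶠ n in atTop, ∀ y ∈ Finset.Ico 0 m, x n ≠ D.site a y :=
      (Finset.eventually_all _).2 fun y _ => hz _
    filter_upwards [hx, hall] with n hn hn'
    by_contra hm
    exact hn' (D.dist a (x n)) (Finset.mem_Ico.2 ⟨hn, not_le.1 hm⟩) (D.site_dist a (x n)).symm
  refine (tendsto_atTop_add_const_right atTop (displacement D.fwd * a) h).congr fun n => ?_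
  rw [dist, dist]
  ring

theorem ae_tendsto_lyap_of_not_tendsto (a : ℤ) : ∀ᵐ s ∂(walkLaw θ k ω),
    ¬ Tendsto (fun n => D.dist 0 (s n).1) atTop atTop →
      Tendsto (fun n => D.lyap a (s n)) atTop (nhds 0) := by
  have hconv := (D.submartingale_lyap k ω a).exists_ae_tendsto_of_bdd (R := D.lyapBound.toNNReal)
    fun n => by
      refine (eLpNorm_le_of_ae_bound (ae_of_all _ fun s => D.abs_lyap_le a (s n))).trans ?_
      simp [ENNReal.ofReal]
  filter_upwards [hconv, ae_all_iff.2 (D.ae_tendsto_lyapBehind k ω)] with s ⟨c, hc⟩ hbehind hs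
  have hfreq : ∃ᶠ n in atTop, D.dist a (s n).1 < 0 := fun h =>
    hs (D.tendsto_dist_of_eventually_nonneg (h.mono fun n hn => not_lt.1 hn)
      (D.eventually_ne_site hbehind))
  have h0 : c = 0 := tendsto_nhds_unique_of_frequently_eq hc (hbehind a)
    (hfreq.mono fun n hn => (Set.indicator_of_mem (by exact hn) (D.lyap a)).symm)
  exact h0 ▸ hc

/-- The walk is transient in the direction of a Lyapunov function. -/
theorem ae_tendsto_dist : ∀ᵐ s ∂(walkLaw θ k ω),
    Tendsto (fun n => D.dist 0 (s n).1) atTop atTop := by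
  have hmeas : @MeasurableSet (ℕ → State θ) (⨆ n, pathFiltration θ n)
      {s : ℕ → State θ | Tendsto (fun n => D.dist 0 (s n).1) atTop atTop} := by
    let _ : MeasurableSpace (ℕ → State θ) := ⨆ n, pathFiltration θ n
    refine measurableSet_tendsto (f := fun n (s : ℕ → State θ) => D.dist 0 (s n).1) atTop
      fun n => ?_
    exact (Measurable.of_discrete (f := fun x : ℤ => D.dist 0 x)).comp (measurable_fst.comp
      ((measurable_eval_pathFiltration θ n).mono (le_iSup _ n) le_rfl))
  exact ae_mem_of_submartingale_family (D.submartingale_lyap k ω) (B := D.lyapBound)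
    (δ := D.lyapFloor) (Real.exp_pos _) (fun a n s => D.abs_lyap_le a (s n)) hmeas
    (D.ae_tendsto_lyap_of_not_tendsto k ω)
    fun n s => ⟨(s n).1, D.lyapFloor_le (by simp [dist])⟩

end LyapunovData

/-- A solution `g` of the balance equation with ratio `ρ > 1` yields a Lyapunov function. -/
theorem exists_lyapunovData (θ : Params) (fwd : Bool) {ρ : ℝ} (hρ : 1 < ρ) (g : Config θ → ℝ)
    (hg : ∀ c, jumpProb θ c fwd * (1 + g (nextConfig θ c fwd)) +
      jumpProb θ c (!fwd) * (-ρ + g (nextConfig θ c (!fwd))) = g c) :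
    ∃ D : LyapunovData θ, D.fwd = fwd := by
  have : Nonempty (Config θ) := ⟨Sum.inl ⟨0, θ.L_pos⟩⟩
  obtain ⟨c₀, hc₀⟩ := Finite.exists_min fun c => jumpProb θ c fwd
  obtain ⟨c₁, hc₁⟩ := Finite.exists_max fun c => |g c|
  have hε := jumpProb_pos θ c₀ fwd
  have hρ0 : 0 < ρ := by linarith
  have hb : 1 < 2 / jumpProb θ c₀ fwd := by
    have := sum_jumpProb θ c₀
    rw [Fintype.sum_bool] at this
    have h1 := jumpProb_pos θ c₀ true
    have h2 := jumpProb_pos θ c₀ false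
    rw [one_lt_div hε]
    cases fwd <;> linarith
  refine ⟨{ fwd := fwd, ρ := ρ, g := g, K := |g c₁|, b := Real.log (2 / jumpProb θ c₀ fwd) / ρ,
            one_lt := hρ, abs_g_le := hc₁, balance := hg,
            b_pos := div_pos (Real.log_pos hb) hρ0, two_le := fun c => ?_ }, rfl⟩
  rw [div_mul_cancel₀ _ hρ0.ne', Real.exp_log (by linarith), ← mul_div_assoc, le_div_iff₀ hε,
    mul_comm]
  exact mul_le_mul_of_nonneg_right (hc₀ c) zero_le_two

theorem ae_rightTransient (θ : Params) (hα : 1 / 2 < alpha θ.p θ.q θ.R θ.L) (k : ℤ) (ω : Env θ) :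
    ∀ᵐ s ∂(walkLaw θ k ω), RightTransient fun n => (s n).1 := by
  have h1 := (alpha_mem_Ioo θ).2
  have hpoisson := sitePotential_poisson θ
  set α := alpha θ.p θ.q θ.R θ.L
  have h0 : 0 < 1 - α := by linarith
  obtain ⟨D, hD⟩ := exists_lyapunovData θ true (ρ := α / (1 - α))
    (by rw [one_lt_div h0]; linarith) (fun c => sitePotential θ c / (1 - α)) fun c => by
      have := hpoisson c
      simp only [jumpProb, Bool.not_true, if_true, Bool.false_eq_true, if_false]
      field_simp
      linear_combination this
  filter_upwards [D.ae_tendsto_dist k ω] with s hs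
  simpa [RightTransient, LyapunovData.dist, hD, displacement] using hs

theorem ae_leftTransient (θ : Params) (hα : alpha θ.p θ.q θ.R θ.L < 1 / 2) (k : ℤ) (ω : Env θ) :
    ∀ᵐ s ∂(walkLaw θ k ω), LeftTransient fun n => (s n).1 := by
  have h0 := (alpha_mem_Ioo θ).1
  have hpoisson := sitePotential_poisson θ
  set α := alpha θ.p θ.q θ.R θ.L
  obtain ⟨D, hD⟩ := exists_lyapunovData θ false (ρ := (1 - α) / α)
    (by rw [one_lt_div h0]; linarith) (fun c => -sitePotential θ c / α) fun c => by
      have := hpoisson c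
      simp only [jumpProb, Bool.not_false, if_true, Bool.false_eq_true, if_false]
      field_simp
      linear_combination -this
  filter_upwards [D.ae_tendsto_dist k ω] with s hs
  simpa [LeftTransient, LyapunovData.dist, hD, displacement] using hs

end FeedbackWalk

theorem theorem1 (θ : FeedbackWalk.Params) :
    -- `α` lies in `(0,1)`
    FeedbackWalk.alpha θ.p θ.q θ.R θ.L ∈ Set.Ioo (0 : ℝ) 1 ∧
    -- `α` is the stationary probability of a right jump in the single site chain
    (∃ π : FeedbackWalk.Config θ → ℝ,
      FeedbackWalk.IsStationary (FeedbackWalk.siteMatrix θ) π ∧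
      (∀ π', FeedbackWalk.IsStationary (FeedbackWalk.siteMatrix θ) π' → π' = π) ∧
      ∑ c, π c * FeedbackWalk.rightProb θ c = FeedbackWalk.alpha θ.p θ.q θ.R θ.L) ∧
    -- the same through the chain which also records the jumps
    (∃ ν : FeedbackWalk.Config θ × Bool → ℝ,
      FeedbackWalk.IsStationary (FeedbackWalk.extSiteMatrix θ) ν ∧
      (∀ ν', FeedbackWalk.IsStationary (FeedbackWalk.extSiteMatrix θ) ν' → ν' = ν) ∧
      ∑ c, ν (c, true) = FeedbackWalk.alpha θ.p θ.q θ.R θ.L) ∧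
    -- the cutoff
    (1 / 2 < FeedbackWalk.alpha θ.p θ.q θ.R θ.L →
      ∀ ω : FeedbackWalk.Env θ, ∀ᵐ s ∂(FeedbackWalk.walkLaw θ 0 ω),
        FeedbackWalk.RightTransient (fun n => (s n).1)) ∧
    (FeedbackWalk.alpha θ.p θ.q θ.R θ.L < 1 / 2 →
      ∀ ω : FeedbackWalk.Env θ, ∀ᵐ s ∂(FeedbackWalk.walkLaw θ 0 ω),
        FeedbackWalk.LeftTransient (fun n => (s n).1)) := by
  open FeedbackWalk in
  exact ⟨alpha_mem_Ioo θ,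
    ⟨siteStationary θ, isStationary_siteStationary θ, fun _ h => h.eq_siteStationary,
      (isStationary_siteStationary θ).sum_rightProb⟩,
    ⟨extSiteStationary θ, isStationary_extSiteStationary θ, fun _ h => h.eq_extSiteStationary,
      by simpa [extSiteStationary, jumpProb] using
        (isStationary_siteStationary θ).sum_rightProb⟩,
    fun h ω => ae_rightTransient θ h 0 ω, fun h ω => ae_leftTransient θ h 0 ω⟩
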